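/- Let $R$ be a commutative Noetherian ring and let $C$ be a semidualizing $R$-module, that is, a finitely generated $R$-module such that the homothety map $R\to\operatorname{Hom}_R(C,C)$ is an isomorphism and $\operatorname{Ext}^i_R(C,C)=0$ for all $i>0$. For a complex $X_\bullet=(\cdots\to X_{i+1}\to X_i\to X_{i-1}\to\cdots)$ of $R$-modules put $\inf X_\bullet=\inf\{i\in\mathbb Z\mid X_i\neq 0\}$ and $\operatorname{hinf}X_\bullet=\inf\{i\in\mathbb Z\mid H_i(X_\bullet)\neq 0\}$. A $C$-quasi-injective resolution of an $R$-module $N$ is a bounded complex $I_\bullet$ of injective $R$-modules such that $\operatorname{Hom}_R(C,I_\bullet)$ is not acyclic and, for every $i\in\mathbb Z$, $H_i(\operatorname{Hom}_R(C,I_\bullet))\cong N^{\oplus b_i}$ for some integer $b_i\ge 0$. The $C$-quasi-injective dimension of $N\neq 0$ is $$C\text{-}\operatorname{qid}_R N=\inf\{\operatorname{hinf}\operatorname{Hom}_R(C,I_\bullet)-\inf\operatorname{Hom}_R(C,I_\bullet)\mid I_\bullet\text{ is a } C\text{-quasi-injective resolution of }N\},$$ with $\inf\emptyset=\infty$, and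 $C\text{-}\operatorname{qid}_R N=-\infty$ if $N=0$. Let $M$ and $N$ be (not necessarily finitely generated) $R$-modules such that $C\text{-}\operatorname{qid}_R N<\infty$ and $\operatorname{Tor}^R_i(C,M)=0$ for all $i>0$. If $\operatorname{Ext}^i_R(M,N)=0$ for all sufficiently large $i$, then $\operatorname{Ext}^i_R(M,N)=0$ for all integers $i\ge 0$ with $i>C\text{-}\operatorname{qid}_R N$. -/

import Mathlib

universe u

open CategoryTheory

noncomputable section

namespace QuasiHom

variable {R : Type u} [CommRing R]

/-- A finitely generated module `C` is semidualizing if the homothety map `R → Hom_R(C, C)` is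
bijective and `Ext^i_R(C, C) = 0` for all `i > 0`. -/
structure IsSemidualizing (C : ModuleCat.{u} R) : Prop where
  finite : Module.Finite R C
  homothety_bijective : Function.Bijective (LinearMap.lsmul R C : R → (C →ₗ[R] C))
  ext_eq_zero : ∀ i : ℕ, 0 < i → Subsingleton (Abelian.Ext C C i)

/-- `inf X = inf {i | X_i ≠ 0}` for a complex `X` with differentials `X_i → X_{i-1}`;
it is `+∞` for the zero complex. -/
def cinf (X : ChainComplex (ModuleCat.{u} R) ℤ) : EReal :=
  sInf ((fun i : ℤ => ((i : ℝ) : EReal)) '' {i : ℤ | ¬ Limits.IsZero (X.X i)})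

/-- `hinf X = inf {i | H_i(X) ≠ 0}`; it is `+∞` for an acyclic complex. -/
def hinf (X : ChainComplex (ModuleCat.{u} R) ℤ) : EReal :=
  sInf ((fun i : ℤ => ((i : ℝ) : EReal)) '' {i : ℤ | ¬ Limits.IsZero (X.homology i)})

/-- A complex is bounded if its nonzero terms lie in a finite range of degrees. -/
def IsBounded (X : ChainComplex (ModuleCat.{u} R) ℤ) : Prop :=
  ∃ a b : ℤ, ∀ i : ℤ, i < a ∨ b < i → Limits.IsZero (X.X i)

/-- The complex `Hom_R(C, X)`, with `Hom_R(C, X_i)` in degree `i`. -/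
def homComplex (C : ModuleCat.{u} R) (X : ChainComplex (ModuleCat.{u} R) ℤ) :
    ChainComplex (ModuleCat.{u} R) ℤ :=
  (((linearCoyoneda R (ModuleCat.{u} R)).obj (Opposite.op C)).mapHomologicalComplex
    (ComplexShape.down ℤ)).obj X

/-- `I` is a `C`-quasi-injective resolution of `N`: a bounded complex of injective modules such
that `Hom_R(C, I)` is not acyclic and each of its homology modules is a direct sum of finitely
many (possibly zero) copies of `N`. -/
structure IsQuasiInjectiveResolution (C N : ModuleCat.{u} R)
    (I : ChainComplex (ModuleCat.{u} R) ℤ) : Prop where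
  bounded : IsBounded I
  injective : ∀ i : ℤ, Injective (I.X i)
  not_acyclic : ¬ (homComplex C I).Acyclic
  homology_iso : ∀ i : ℤ, ∃ b : ℕ,
    Nonempty ((homComplex C I).homology i ≅ ModuleCat.of R (Fin b → N))

open Classical in
/-- The `C`-quasi-injective dimension of `N`: it is `-∞` if `N = 0`, and otherwise the infimum of
`hinf Hom_R(C, I) - inf Hom_R(C, I)` over the `C`-quasi-injective resolutions `I` of `N`
(so `+∞` if there are none). -/
def cqid (C N : ModuleCat.{u} R) : EReal :=
  if Limits.IsZero N then ⊥
  else sInf {d : EReal | ∃ I : ChainComplex (ModuleCat.{u} R) ℤ,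
    IsQuasiInjectiveResolution C N I ∧ d = hinf (homComplex C I) - cinf (homComplex C I)}

end QuasiHom

end

/-!
Let `I` be a `C`-quasi-injective resolution of `N` and `J = Hom(C, I)`. For `E` injective,
`Ext^i(M, Hom(C, E)) ≅ Hom(Tor_i(C, M), E)`, so all terms of `J` are `Ext(M, -)`-acyclic. Let `J`
start in degree `s` and have its lowest nonzero homology in degree `s + d`. Below that degree `J` is
exact, so `d` dimension shifts give `Ext^i(M, Z_{s+d}) = 0` for `i > d`. If moreover
`Ext^i(M, N) = 0` for all `i > n + 1`, where `n ≥ d`, then dimension shifting down from the upper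
end of `J` yields the same vanishing for all cycles, and the sequence
`0 → B_{s+d} → Z_{s+d} → H_{s+d} → 0` improves it to `Ext^i(M, H_{s+d}) = 0` for all `i > n`. As `N`
is a direct summand of `H_{s+d}`, the bound on the nonvanishing degrees descends step by step to
`d`.
-/

namespace QuasiHom

open Limits Abelian

section ExtVanishing

variable {A : Type*} [Category* A] [Abelian A] [HasExt A]

lemma subsingleton_ext_of_isZero (M : A) {Y : A} (hY : IsZero Y) (i : ℕ) :
    Subsingleton (Ext M Y i) := by
  refine subsingleton_of_forall_eq 0 fun x => ?_
  rw [← Ext.comp_mk₀_id x, hY.eq_of_src (𝟙 Y) 0, Ext.mk₀_zero, Ext.comp_zero]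

/-- The objects `Y` with `Ext^i(M, Y) = 0` for all `i > n`. -/
def extVanishingAbove (M : A) (n : ℕ) : ObjectProperty A :=
  fun Y => ∀ i : ℕ, n < i → Subsingleton (Ext M Y i)

variable (M : A)

lemma extVanishingAbove_mono {m n : ℕ} (hmn : m ≤ n) :
    extVanishingAbove M m ≤ extVanishingAbove M n :=
  fun _ hY i hi => hY i (hmn.trans_lt hi)

instance (n : ℕ) : (extVanishingAbove M n).IsStableUnderRetracts where
  of_retract r hY i hi := by
    have := hY i hi
    have hinv : Function.LeftInverse (fun y => y.comp (Ext.mk₀ r.r) (add_zero i))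
        (fun x : Ext M _ i => x.comp (Ext.mk₀ r.i) (add_zero i)) := fun x => by simp
    exact hinv.injective.subsingleton

open scoped ZeroObject in
instance (n : ℕ) : (extVanishingAbove M n).ContainsZero where
  exists_zero := ⟨0, isZero_zero A, fun i _ => subsingleton_ext_of_isZero M (isZero_zero A) i⟩

instance (n : ℕ) : (extVanishingAbove M n).IsClosedUnderExtensions where
  prop_X₂_of_shortExact hS h₁ h₃ i hi := subsingleton_of_forall_eq 0 fun x => by
    obtain ⟨y, rfl⟩ := Ext.covariant_sequence_exact₂ M hS x ((h₃ i hi).elim _ _)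
    rw [(h₁ i hi).elim y 0, Ext.zero_comp]

lemma extVanishingAbove_X₃ {S : ShortComplex A} (hS : S.ShortExact) {n : ℕ}
    (h₁ : extVanishingAbove M (n + 1) S.X₁) (h₂ : extVanishingAbove M n S.X₂) :
    extVanishingAbove M n S.X₃ := fun i hi => subsingleton_of_forall_eq 0 fun x => by
  obtain ⟨y, rfl⟩ := Ext.covariant_sequence_exact₃ M hS x rfl ((h₁ (i + 1) (by lia)).elim _ _)
  rw [(h₂ i hi).elim y 0, Ext.zero_comp]

lemma extVanishingAbove_succ_X₁ {S : ShortComplex A} (hS : S.ShortExact) {n : ℕ}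
    (h₂ : extVanishingAbove M (n + 1) S.X₂) (h₃ : extVanishingAbove M n S.X₃) :
    extVanishingAbove M (n + 1) S.X₁ := by
  rintro (_ | i) hi
  · lia
  refine subsingleton_of_forall_eq 0 fun x => ?_
  obtain ⟨y, rfl⟩ := Ext.covariant_sequence_exact₁ M hS x ((h₂ (i + 1) hi).elim _ _) rfl
  rw [(h₃ i (by lia)).elim y 0, Ext.zero_comp]

lemma extVanishingAbove_biproduct {J : Type*} [Finite J] {Y : J → A} [HasBiproduct Y] {n : ℕ}
    (hY : ∀ j, extVanishingAbove M n (Y j)) : extVanishingAbove M n (⨁ Y) := fun i hi => by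
  have := Fintype.ofFinite J
  have (j : J) := hY j i hi
  exact (Ext.addEquivBiproduct M (biproduct.isBilimit Y) i).subsingleton

/-- Applying `Hom(-, E)` to the complex computing the left derived functors of `F` gives, by
adjunction, the complex computing `Ext(M, G E)`. -/
lemma subsingleton_ext_of_isZero_leftDerived [HasProjectiveResolutions A]
    {B : Type*} [Category* B] [Abelian B] {F : A ⥤ B} [F.Additive] {G : B ⥤ A} (adj : F ⊣ G)
    (E : B) [Injective E] {i : ℕ} (hF : IsZero ((F.leftDerived (i + 1)).obj M)) :
    Subsingleton (Ext M (G.obj E) (i + 1)) := by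
  refine subsingleton_of_forall_eq 0 fun x => ?_
  let P := projectiveResolution M
  obtain ⟨f, hf, rfl⟩ := P.extMk_surjective x (i + 2) rfl
  rw [P.extMk_eq_zero_iff f _ _ _ i rfl]
  let K := (F.mapHomologicalComplex (ComplexShape.down ℕ)).obj P.complex
  have hK : (K.sc' (i + 2) (i + 1) i).Exact := by
    rw [← K.exactAt_iff' (i + 2) (i + 1) i (by simp) (by simp), K.exactAt_iff_isZero_homology]
    exact hF.of_iso (P.isoLeftDerivedObj F (i + 1)).symm
  have hf' : F.map (P.complex.d (i + 2) (i + 1)) ≫ (adj.homEquiv _ _).symm f = 0 := by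
    rw [← adj.homEquiv_naturality_left_symm, hf, adj.homEquiv_counit, F.map_zero, zero_comp]
  obtain ⟨g, hg⟩ : ∃ g : F.obj (P.complex.X i) ⟶ E,
      F.map (P.complex.d (i + 1) i) ≫ g = (adj.homEquiv _ _).symm f :=
    ⟨_, hK.comp_descToInjective _ hf'⟩
  exact ⟨adj.homEquiv _ _ g, by
    rw [← adj.homEquiv_naturality_left, hg, Equiv.apply_symm_apply]⟩

end ExtVanishing

section Boundaries

variable {A ι : Type*} [Category* A] [Abelian A] {c : ComplexShape ι} (K : HomologicalComplex A c)

/-- The boundaries of a complex in degree `j`, encoded as the kernel of `Z_j ⟶ H_j` so as not to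
refer to the previous degree. -/
noncomputable abbrev boundaries (j : ι) : A := kernel (K.homologyπ j)

/-- The short complex `B_j ⟶ Z_j ⟶ H_j`. -/
noncomputable abbrev boundariesCyclesHomology (j : ι) : ShortComplex A :=
  ShortComplex.mk (kernel.ι (K.homologyπ j)) (K.homologyπ j) (kernel.condition _)

lemma boundariesCyclesHomology_shortExact (j : ι) : (boundariesCyclesHomology K j).ShortExact where
  exact := ShortComplex.exact_kernel _

/-- The short complex `Z_i ⟶ X_i ⟶ B_j`, of interest when the differential of the complex goes
from degree `i` to degree `j`. -/
noncomputable abbrev cyclesXBoundaries (i j : ι) : ShortComplex A :=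
  ShortComplex.mk (K.iCycles i)
    (kernel.lift (K.homologyπ j) (K.toCycles i j) (K.toCycles_comp_homologyπ i j)) (by
      rw [← cancel_mono (kernel.ι _), ← cancel_mono (K.iCycles j)]
      simp)

lemma cyclesXBoundaries_shortExact {i j : ι} (hij : c.Rel i j) :
    (cyclesXBoundaries K i j).ShortExact where
  exact := by
    refine ShortComplex.exact_of_f_is_kernel _ (KernelFork.IsLimit.ofι' _ _ fun f hf => ?_)
    have hf' : f ≫ K.d i j = 0 := by
      simpa using hf =≫ (kernel.ι (K.homologyπ j) ≫ K.iCycles j)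
    exact ⟨K.liftCycles f j (c.next_eq' hij) hf', K.liftCycles_i f j _ hf'⟩
  epi_g := by
    have hex : (ShortComplex.mk (K.toCycles i j) (K.homologyπ j)
        (K.toCycles_comp_homologyπ i j)).Exact :=
      ShortComplex.exact_of_g_is_cokernel _ (K.homologyIsCokernel i j (c.prev_eq' hij))
    exact (ShortComplex.exact_iff_epi_kernel_lift _).1 hex

end Boundaries

section AcyclicTerms

variable {A : Type*} [Category* A] [Abelian A] [HasExt A] (M : A) {X : ChainComplex A ℤ}

lemma extVanishingAbove_cycles_of_isZero_homology (hX : ∀ k, extVanishingAbove M 0 (X.X k))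
    {s : ℤ} (hs : ∀ k < s, IsZero (X.X k)) (d : ℕ) (hd : ∀ k < s + d, IsZero (X.homology k)) :
    extVanishingAbove M d (X.cycles (s + d)) := by
  induction d with
  | zero =>
    have hB : IsZero (boundaries X (s - 1)) :=
      IsZero.of_mono (kernel.ι (X.homologyπ (s - 1)) ≫ X.iCycles (s - 1)) (hs _ (by lia))
    have : IsIso (X.iCycles s) :=
      (cyclesXBoundaries_shortExact X (i := s) (j := s - 1) (by simp)).isIso_f_iff.2 hB
    simpa using (extVanishingAbove M 0).prop_of_iso (asIso (X.iCycles s)).symm (hX s)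
  | succ d ih =>
    have hZ : extVanishingAbove M d (X.cycles (s + d)) := ih fun k hk => hd k (by lia)
    have : IsIso (kernel.ι (X.homologyπ (s + d))) :=
      (boundariesCyclesHomology_shortExact X (s + d)).isIso_f_iff.2 (hd _ (by lia))
    have hB : extVanishingAbove M d (boundaries X (s + d)) :=
      (extVanishingAbove M d).prop_of_iso (asIso (kernel.ι (X.homologyπ (s + d)))).symm hZ
    exact extVanishingAbove_succ_X₁ M
      (cyclesXBoundaries_shortExact X (i := s + (d + 1 : ℕ)) (by simp; lia))
      (extVanishingAbove_mono M (Nat.zero_le _) _ (hX _)) hB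

lemma extVanishingAbove_boundaries {k : ℤ} {n : ℕ} (hX : extVanishingAbove M n (X.X (k + 1)))
    (hZ : extVanishingAbove M (n + 1) (X.cycles (k + 1))) :
    extVanishingAbove M n (boundaries X k) :=
  extVanishingAbove_X₃ M (cyclesXBoundaries_shortExact X (by simp)) hZ hX

lemma extVanishingAbove_cycles_of_homology {n : ℕ} (hX : ∀ k, extVanishingAbove M n (X.X k))
    {b : ℤ} (hb : ∀ k, b < k → IsZero (X.X k)) (hH : ∀ k, extVanishingAbove M n (X.homology k))
    (k : ℤ) : extVanishingAbove M n (X.cycles k) := by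
  obtain ⟨m, hm⟩ : ∃ m : ℕ, b < k + m := ⟨(b - k + 1).toNat, by lia⟩
  induction m generalizing k with
  | zero =>
    exact (extVanishingAbove M n).prop_of_isZero (IsZero.of_mono (X.iCycles k) (hb k (by lia)))
  | succ m ih =>
    have hB : extVanishingAbove M n (boundaries X k) :=
      extVanishingAbove_boundaries M (hX (k + 1))
        (extVanishingAbove_mono M (Nat.le_succ n) _ (ih (k + 1) (by lia)))
    exact (extVanishingAbove M n).prop_X₂_of_shortExact
      (boundariesCyclesHomology_shortExact X k) hB (hH k)

/-- The sequence `B_{s+d} ⟶ Z_{s+d} ⟶ H_{s+d}` gains one degree: its cycles are controlled from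
below, by exactness, and its boundaries from above, by all the homology. -/
lemma extVanishingAbove_homology_of_succ (hX : ∀ k, extVanishingAbove M 0 (X.X k))
    {s b : ℤ} (hs : ∀ k < s, IsZero (X.X k)) (hb : ∀ k, b < k → IsZero (X.X k))
    {d n : ℕ} (hd : ∀ k < s + d, IsZero (X.homology k)) (hdn : d ≤ n)
    (hH : ∀ k, extVanishingAbove M (n + 1) (X.homology k)) :
    extVanishingAbove M n (X.homology (s + d)) := by
  have hX' (k : ℤ) : extVanishingAbove M (n + 1) (X.X k) :=
    extVanishingAbove_mono M (Nat.zero_le _) _ (hX k)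
  have hB : extVanishingAbove M (n + 1) (boundaries X (s + d)) :=
    extVanishingAbove_boundaries M (hX' _)
      (extVanishingAbove_mono M (Nat.le_succ _) _
        (extVanishingAbove_cycles_of_homology M hX' hb hH _))
  have hZ : extVanishingAbove M n (X.cycles (s + d)) :=
    extVanishingAbove_mono M hdn _ (extVanishingAbove_cycles_of_isZero_homology M hX hs d hd)
  exact extVanishingAbove_X₃ M (boundariesCyclesHomology_shortExact X (s + d)) hB hZ

end AcyclicTerms

section Module

variable {R : Type u} [CommRing R] {C M N : ModuleCat.{u} R}

lemma extVanishingAbove_pi {ι : Type} [Finite ι] {n : ℕ} (hN : extVanishingAbove M n N) :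
    extVanishingAbove M n (ModuleCat.of R (ι → N)) :=
  (extVanishingAbove M n).prop_of_iso (ModuleCat.biproductIsoPi fun _ : ι => N)
    (extVanishingAbove_biproduct M fun _ => hN)

lemma extVanishingAbove_of_pi {ι : Type} [Finite ι] [Nonempty ι] {n : ℕ}
    (h : extVanishingAbove M n (ModuleCat.of R (ι → N))) : extVanishingAbove M n N :=
  ObjectProperty.IsStableUnderRetracts.of_biproduct _ (fun _ : ι => N)
    ((extVanishingAbove M n).prop_of_iso (ModuleCat.biproductIsoPi fun _ : ι => N).symm h)
    (Classical.arbitrary ι)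

lemma extVanishingAbove_homComplex_X
    (hTor : ∀ i : ℕ, 0 < i → IsZero (((Tor (ModuleCat.{u} R) i).obj C).obj M))
    {I : ChainComplex (ModuleCat.{u} R) ℤ} {k : ℤ} (hI : Injective (I.X k)) :
    extVanishingAbove M 0 ((homComplex C I).X k) := by
  rintro (_ | i) hi
  · lia
  exact subsingleton_ext_of_isZero_leftDerived M (ihom.adjunction C) (I.X k) (hTor _ hi)

lemma isZero_homComplex_X {I : ChainComplex (ModuleCat.{u} R) ℤ} {k : ℤ} (h : IsZero (I.X k)) :
    IsZero ((homComplex C I).X k) :=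
  Functor.map_isZero ((linearCoyoneda R (ModuleCat.{u} R)).obj (Opposite.op C)) h

lemma exists_sInf_image_intCast_eq {S : Set ℤ} (hS : S.Nonempty) (hbdd : BddBelow S) :
    ∃ a ∈ S, (∀ k < a, k ∉ S) ∧
      sInf ((fun i : ℤ => ((i : ℝ) : EReal)) '' S) = ((a : ℝ) : EReal) := by
  obtain ⟨a, ha, hle⟩ := Int.exists_least_of_bdd (P := (· ∈ S)) hbdd hS
  refine ⟨a, ha, fun k hk hkS => (hle k hkS).not_gt hk, IsLeast.csInf_eq ⟨⟨a, ha, rfl⟩, ?_⟩⟩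
  rintro _ ⟨k, hk, rfl⟩
  exact EReal.coe_le_coe (Int.cast_le.2 (hle k hk))

namespace IsQuasiInjectiveResolution

variable {I : ChainComplex (ModuleCat.{u} R) ℤ}

lemma exists_hinf_sub_cinf_eq (hI : IsQuasiInjectiveResolution C N I) :
    ∃ (s : ℤ) (d : ℕ), (∀ k < s, IsZero ((homComplex C I).X k)) ∧
      (∀ k < s + d, IsZero ((homComplex C I).homology k)) ∧
      ¬ IsZero ((homComplex C I).homology (s + d)) ∧
      hinf (homComplex C I) - cinf (homComplex C I) = ((d : ℝ) : EReal) := by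
  set J := homComplex C I
  obtain ⟨a, b, hab⟩ := hI.bounded
  have hsub : {k | ¬ IsZero (J.homology k)} ⊆ {k | ¬ IsZero (J.X k)} := fun k =>
    mt fun hk => (HomologicalComplex.ExactAt.of_isZero hk).isZero_homology
  have hbdd : BddBelow {k | ¬ IsZero (J.X k)} :=
    ⟨a, fun k hk => not_lt.1 fun hka => hk (isZero_homComplex_X (hab k (.inl hka)))⟩
  have hne : {k | ¬ IsZero (J.homology k)}.Nonempty := by
    by_contra! h
    exact hI.not_acyclic fun k => (J.exactAt_iff_isZero_homology k).2
      (not_not.1 (Set.eq_empty_iff_forall_notMem.1 h k))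
  obtain ⟨h, hh, hlt, hinf_eq⟩ := exists_sInf_image_intCast_eq hne (hbdd.mono hsub)
  obtain ⟨s, -, hs, hcinf_eq⟩ := exists_sInf_image_intCast_eq (hne.mono hsub) hbdd
  obtain ⟨d, rfl⟩ := Int.le.dest (not_lt.1 fun hlt => hs h hlt (hsub hh))
  refine ⟨s, d, fun k hk => not_not.1 (hs k hk), fun k hk => not_not.1 (hlt k hk), hh, ?_⟩
  rw [hinf, cinf, hinf_eq, hcinf_eq, ← EReal.coe_sub]
  simp

lemma extVanishingAbove_homology (hI : IsQuasiInjectiveResolution C N I) {n : ℕ}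
    (hN : extVanishingAbove M n N) (k : ℤ) :
    extVanishingAbove M n ((homComplex C I).homology k) := by
  obtain ⟨b, ⟨e⟩⟩ := hI.homology_iso k
  exact (extVanishingAbove M n).prop_of_iso e.symm (extVanishingAbove_pi hN)

lemma extVanishingAbove_of_homology (hI : IsQuasiInjectiveResolution C N I) {n : ℕ} {k : ℤ}
    (hk : ¬ IsZero ((homComplex C I).homology k))
    (hH : extVanishingAbove M n ((homComplex C I).homology k)) : extVanishingAbove M n N := by
  obtain ⟨b, ⟨e⟩⟩ := hI.homology_iso k
  have : NeZero b := ⟨by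
    rintro rfl
    exact hk ((ModuleCat.isZero_of_subsingleton _).of_iso e)⟩
  exact extVanishingAbove_of_pi ((extVanishingAbove M n).prop_of_iso e hH)

lemma exists_hinf_sub_cinf_eq_and_extVanishingAbove (hI : IsQuasiInjectiveResolution C N I)
    (hTor : ∀ i : ℕ, 0 < i → IsZero (((Tor (ModuleCat.{u} R) i).obj C).obj M))
    (hExt : ∃ n, extVanishingAbove M n N) :
    ∃ d : ℕ, hinf (homComplex C I) - cinf (homComplex C I) = ((d : ℝ) : EReal) ∧
      extVanishingAbove M d N := by
  obtain ⟨s, d, hs, hd, hne, heq⟩ := hI.exists_hinf_sub_cinf_eq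
  obtain ⟨a, b, hab⟩ := hI.bounded
  obtain ⟨m, hm⟩ := hExt
  have descent (n : ℕ) (hdn : d ≤ n) (hN : extVanishingAbove M (n + 1) N) :
      extVanishingAbove M n N :=
    hI.extVanishingAbove_of_homology hne <|
      extVanishingAbove_homology_of_succ M
        (fun k => extVanishingAbove_homComplex_X hTor (hI.injective k)) hs
        (fun k hk => isZero_homComplex_X (hab k (.inr hk))) hd hdn
        (hI.extVanishingAbove_homology hN)
  exact ⟨d, heq, Nat.decreasingInduction' (fun n _ => descent n) (le_max_left d m)
    (extVanishingAbove_mono M (le_max_right d m) N hm)⟩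

end IsQuasiInjectiveResolution

end Module

end QuasiHom

open QuasiHom in
theorem mainTheorem12_general {R : Type u} [CommRing R] (C M N : ModuleCat.{u} R)
    (hTor : ∀ i : ℕ, 0 < i → Limits.IsZero (((Tor (ModuleCat.{u} R) i).obj C).obj M))
    (hExt : ∃ n : ℕ, ∀ i : ℕ, n < i → Subsingleton (Abelian.Ext M N i)) :
    ∀ i : ℕ, QuasiHom.cqid C N < ((i : ℝ) : EReal) → Subsingleton (Abelian.Ext M N i) := by
  intro i hi
  by_cases hN : Limits.IsZero N
  · exact subsingleton_ext_of_isZero M hN i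
  rw [cqid, if_neg hN, sInf_lt_iff] at hi
  obtain ⟨_, ⟨I, hI, rfl⟩, hlt⟩ := hi
  obtain ⟨d, hd, hEV⟩ := hI.exists_hinf_sub_cinf_eq_and_extVanishingAbove hTor hExt
  rw [hd] at hlt
  exact hEV i (by exact_mod_cast hlt)

theorem mainTheorem12 {R : Type u} [CommRing R] [IsNoetherianRing R]
    (C M N : ModuleCat.{u} R) (hC : QuasiHom.IsSemidualizing C)
    (hN : QuasiHom.cqid C N < ⊤)
    (hTor : ∀ i : ℕ, 0 < i → Limits.IsZero (((Tor (ModuleCat.{u} R) i).obj C).obj M))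
    (hExt : ∃ n : ℕ, ∀ i : ℕ, n < i → Subsingleton (Abelian.Ext M N i)) :
    ∀ i : ℕ, QuasiHom.cqid C N < ((i : ℝ) : EReal) → Subsingleton (Abelian.Ext M N i) :=
  mainTheorem12_general C M N hTor hExt
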